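/- Let $\mathbb D^2\subset\mathbb C^2$ be the unit bidisk. For an ideal $\mathcal I$ of the ring $\mathcal O(\mathbb D^2)$ of holomorphic functions, with finitely many generators $\psi_j$ and zero locus $V(\mathcal I)$, let $G_{\mathcal I}(z)$ be the supremum of $u(z)$ over all nonpositive plurisubharmonic functions $u$ on $\mathbb D^2$ such that $u\le\max_j\log|\psi_j|+O(1)$ near each point of $V(\mathcal I)$. For a finite set $S$, let $G_S=G_{\mathcal I(S)}$, where $\mathcal I(S)$ is the ideal of all functions in $\mathcal O(\mathbb D^2)$ that vanish on $S$. Let $E\subset\mathbb C\setminus\{0\}$ be a set of parameters with $0\in\overline E$, and for $\varepsilon\in E$ let $$S_\varepsilon=\{(0,0),\ (\varepsilon,0),\ (\rho(\varepsilon),\delta(\varepsilon)\rho(\varepsilon))\},\qquad G_\varepsilon=G_{S_\varepsilon},$$ where $\rho(\varepsilon),\delta(\varepsilon)\in\mathbb C\setminus\{0\}$, $|\rho(\varepsilon)|\le|\varepsilon|$ and $|\rho(\varepsilon)|\le|\varepsilon-\rho(\varepsilon)|$ (both inequalities hold, for instance, if $|\rho(\varepsilon)|\le\frac12|\varepsilon|$),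 and $\delta(\varepsilon)\to0$ as $E\ni\varepsilon\to0$. Assume that $$\frac{\log|\delta(\varepsilon)|}{\log|\varepsilon|}\longrightarrow0\quad\text{as }E\ni\varepsilon\to0.$$ Then for every $z=(z_1,z_2)\in\mathbb D^2\setminus\{(0,0)\}$, $$\limsup_{E\ni\varepsilon\to0}G_\varepsilon(z)\le\tfrac32\log\max(|z_1|,|z_2|).$$ -/

import Mathlib

open Set Filter Topology MeasureTheory

open scoped ENNReal

noncomputable section

namespace GreenLimit

/-- The algebra `𝒪(Ω)` of holomorphic functions on the (open) set `Ω`, as functions on the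
subtype `Ω`. -/
def holo {E : Type*} [NormedAddCommGroup E] [NormedSpace ℂ E] (Ω : Set E) :
    Subalgebra ℂ (Ω → ℂ) where
  carrier := {f | ∃ F : E → ℂ, DifferentiableOn ℂ F Ω ∧ ∀ z : Ω, F z = f z}
  mul_mem' := by
    rintro f g ⟨F, hF, hFf⟩ ⟨G, hG, hGg⟩
    exact ⟨fun z => F z * G z, hF.mul hG, fun z => by simp [hFf, hGg]⟩
  add_mem' := by
    rintro f g ⟨F, hF, hFf⟩ ⟨G, hG, hGg⟩
    exact ⟨fun z => F z + G z, hF.add hG, fun z => by simp [hFf, hGg]⟩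
  algebraMap_mem' := fun c =>
    ⟨fun _ => c, differentiableOn_const c, fun z => by simp [Pi.algebraMap_apply]⟩

/-- The ideal `ℐ(S)` of all holomorphic functions on `Ω` vanishing on `S`. -/
def vanishingIdeal {E : Type*} [NormedAddCommGroup E] [NormedSpace ℂ E] (Ω S : Set E) :
    Ideal (holo Ω) where
  carrier := {f | ∀ z : Ω, (z : E) ∈ S → f.1 z = 0}
  zero_mem' := fun z _ => rfl
  add_mem' := by
    intro f g hf hg z hz
    have h : (f + g).1 z = f.1 z + g.1 z := rfl
    rw [h, hf z hz, hg z hz, add_zero]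
  smul_mem' := by
    intro c f hf z hz
    have h : (c • f).1 z = c.1 z * f.1 z := rfl
    rw [h, hf z hz, mul_zero]

/-- The zero locus `V(ℐ)` in `Ω` of an ideal of `𝒪(Ω)`. -/
def zeroLocus {E : Type*} [NormedAddCommGroup E] [NormedSpace ℂ E] {Ω : Set E}
    (I : Ideal (holo Ω)) : Set Ω :=
  {z | ∀ f ∈ I, f.1 z = 0}

/-- The mean `(1 / 2π) ∫₀^{2π} f(θ) dθ` of an extended-real-valued function, as the mean of the
positive part minus the mean of the negative part.  It is used for functions bounded above, whose
positive part has a finite mean; the value `-∞` is allowed. -/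
def circleMean (f : ℝ → EReal) : EReal :=
  ((ENNReal.ofReal (2 * Real.pi)⁻¹ * ∫⁻ θ in Ioc 0 (2 * Real.pi), (f θ).toENNReal : ℝ≥0∞) : EReal)
    - ((ENNReal.ofReal (2 * Real.pi)⁻¹ *
        ∫⁻ θ in Ioc 0 (2 * Real.pi), (-f θ).toENNReal : ℝ≥0∞) : EReal)

/-- `u` is plurisubharmonic on the (open) set `Ω`: it is upper semicontinuous on `Ω` with values
in `[-∞, ∞)`, and it satisfies the sub-mean value inequality on every closed affine complex disk
contained in `Ω`.  The constant `-∞` is allowed. -/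
structure IsPSH {E : Type*} [NormedAddCommGroup E] [NormedSpace ℂ E]
    (u : E → EReal) (Ω : Set E) : Prop where
  usc : UpperSemicontinuousOn u Ω
  lt_top : ∀ z ∈ Ω, u z < ⊤
  le_mean : ∀ a b : E, (∀ ζ : ℂ, ‖ζ‖ ≤ 1 → a + ζ • b ∈ Ω) →
    u a ≤ circleMean fun θ => u (a + Complex.exp (θ * Complex.I) • b)

/-- `max_j log |ψ_j(z)|` for a finite family of holomorphic functions, with `log 0 = -∞`. -/
def maxLog {E : Type*} [NormedAddCommGroup E] [NormedSpace ℂ E] {Ω : Set E} {m : ℕ}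
    (ψ : Fin m → holo Ω) (z : Ω) : EReal :=
  ⨆ j, ENNReal.log ‖(ψ j).1 z‖ₑ

/-- The functions competing in the definition of the Green function of the ideal `I`: the
nonpositive plurisubharmonic functions `u` on `Ω` with `u ≤ max_j log |ψ_j| + O(1)` near each point
of `V(I)`, where the `ψ_j` are finitely many generators of `I`.  Two finite families of generators
bound each other locally up to a constant factor, so their choice does not matter. -/
def IsCompetitor {E : Type*} [NormedAddCommGroup E] [NormedSpace ℂ E] {Ω : Set E}
    (I : Ideal (holo Ω)) (u : E → EReal) : Prop :=
  IsPSH u Ω ∧ (∀ z ∈ Ω, u z ≤ 0) ∧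
    ∃ (m : ℕ) (ψ : Fin m → holo Ω), Ideal.span (range ψ) = I ∧
      ∀ a ∈ zeroLocus I, ∃ C : ℝ, ∀ᶠ z : Ω in 𝓝 a, u z ≤ maxLog ψ z + (C : EReal)

/-- The pluricomplex Green function `G_I^Ω` of an ideal `I` of `𝒪(Ω)`. -/
def greenIdeal {E : Type*} [NormedAddCommGroup E] [NormedSpace ℂ E] {Ω : Set E}
    (I : Ideal (holo Ω)) (z : E) : EReal :=
  sSup {t | ∃ u : E → EReal, IsCompetitor I u ∧ u z = t}

/-- The pluricomplex Green function `G_S = G_{ℐ(S)}` on `Ω` with poles in the set `S`. -/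
def greenSet {E : Type*} [NormedAddCommGroup E] [NormedSpace ℂ E] (Ω S : Set E) (z : E) : EReal :=
  greenIdeal (vanishingIdeal Ω S) z

/-- The unit bidisk `𝔻²` in `ℂ²`. -/
def bidisk : Set (ℂ × ℂ) := Metric.ball 0 1 ×ˢ Metric.ball 0 1

/-- The three poles `(0, 0)`, `(ε, 0)`, `(ρ, δρ)`. -/
def threePoints (ε ρ δ : ℂ) : Set (ℂ × ℂ) := {(0, 0), (ε, 0), (ρ, δ * ρ)}

end GreenLimit

end

namespace GreenLimit

open Metric Real

/-! Let M = max(|z₁|, |z₂|). Along a closed analytic disk φ in the bidisk that meets the poles at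
parameters a ∈ A, the maximum principle bounds the Green function at φ(s) by ∑ (log |s - a| - log (1
- |a|)) (`greenSet_le_logPoles`). So it suffices to find, for small ε, a disk with φ(s) = z that
meets the three poles at 0, α, β, where α, β → 0 and s² is slightly larger than M: the bound then
tends to 3 log s, which is close to (3/2) log M.

Such a disk is a perturbation of a doubly covered line ζ ↦ ζ²v. A conic ζ(ζv + w) passes through the
poles with |α|² = O(|δε|), |β| ≤ 2|α|, |w₂| = O(|α|) and |w₁| = O((|ε|/|δ|)^(1/2) + |α|)
(`exists_conic_through_threePoints`). The logarithmic hypothesis gives |ε| ≤ |δ|² eventually, so all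
these parameters tend to 0 (`eventually_exists_conic`). A cubic term vanishing at 0, α, β then moves
the value at s to z exactly.

Plurisubharmonicity is tested on affine disks only, so the maximum principle along curved disks
(`IsPSH.comp_le`) is proved by doubling the variables, as for viscosity solutions. -/

/-! ### Circle means and the sub-mean value inequality -/

theorem circleMean_mono {f g : ℝ → EReal} (h : ∀ θ, f θ ≤ g θ) : circleMean f ≤ circleMean g := by
  unfold circleMean
  refine EReal.sub_le_sub ?_ ?_ <;> refine EReal.coe_ennreal_le_coe_ennreal_iff.2 ?_ <;> gcongr
  · exact EReal.toENNReal_le_toENNReal (h _)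
  · exact EReal.toENNReal_le_toENNReal (EReal.neg_le_neg_iff.2 (h _))

theorem circleMean_coe {f : ℝ → ℝ} (hf : IntegrableOn f (Ioc 0 (2 * π))) :
    circleMean (fun θ => (f θ : EReal)) = (((2 * π)⁻¹ * ∫ θ in Ioc 0 (2 * π), f θ : ℝ) : EReal) := by
  have hpos : (∫⁻ θ in Ioc 0 (2 * π), ENNReal.ofReal (f θ)) ≠ ∞ :=
    (hf.lintegral_lt_top).ne
  have hneg : (∫⁻ θ in Ioc 0 (2 * π), ENNReal.ofReal (-f θ)) ≠ ∞ :=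
    (hf.neg.lintegral_lt_top).ne
  rw [integral_eq_lintegral_pos_part_sub_lintegral_neg_part hf]
  unfold circleMean
  simp only [← EReal.coe_neg, EReal.real_coe_toENNReal]
  have key : ∀ a : ℝ≥0∞, a ≠ ∞ → ((ENNReal.ofReal (2 * π)⁻¹ * a : ℝ≥0∞) : EReal)
      = (((2 * π)⁻¹ * a.toReal : ℝ) : EReal) := by
    intro a ha
    rw [← EReal.coe_ennreal_toReal (ENNReal.mul_ne_top ENNReal.ofReal_ne_top ha), ENNReal.toReal_mul,
      ENNReal.toReal_ofReal (by positivity)]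
  rw [key _ hpos, key _ hneg, ← EReal.coe_sub, mul_sub]

/-- A plurisubharmonic function is bounded at the center of an affine disk by the mean of any
continuous majorant on the boundary circle. -/
theorem IsPSH.le_circleAverage {E : Type*} [NormedAddCommGroup E] [NormedSpace ℂ E]
    {u : E → EReal} {Ω : Set E} (hu : IsPSH u Ω) {p b : E} {c : ℂ} {r : ℝ} (hr : 0 < r)
    (hdisk : ∀ ζ ∈ closedBall c r, p + (ζ - c) • b ∈ Ω) {g : ℂ → ℝ}
    (hg : ContinuousOn g (sphere c r))
    (hle : ∀ ζ ∈ sphere c r, u (p + (ζ - c) • b) ≤ g ζ) :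
    u p ≤ (circleAverage g c r : ℝ) := by
  have hmap : ∀ θ : ℝ, circleMap c r θ - c = (r : ℂ) * Complex.exp (θ * Complex.I) := by
    intro θ; simp [circleMap]
  have hcont : Continuous fun θ => g (circleMap c r θ) :=
    hg.comp_continuous (continuous_circleMap c r) fun θ => circleMap_mem_sphere c hr.le θ
  have h1 := hu.le_mean p ((r : ℂ) • b) (by
    intro ζ hζ
    have := hdisk (c + r * ζ) (by
      simp only [mem_closedBall, dist_eq_norm, add_sub_cancel_left, norm_mul, Complex.norm_real,
        norm_eq_abs, abs_of_pos hr]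
      nlinarith)
    rwa [add_sub_cancel_left, mul_comm, mul_smul] at this)
  refine h1.trans ((circleMean_mono (g := fun θ => (g (circleMap c r θ) : EReal)) ?_).trans ?_)
  · intro θ
    have := hle _ (circleMap_mem_sphere c hr.le θ)
    rwa [hmap, mul_comm, mul_smul] at this
  · rw [circleMean_coe (hcont.integrableOn_Ioc), circleAverage_def,
      intervalIntegral.integral_of_le (by positivity), smul_eq_mul]

/-- Orthogonality of the constant term of a holomorphic function to the remainder on circles. -/
theorem circleAverage_norm_sq {f : ℂ → ℂ} (hf : Differentiable ℂ f) (c : ℂ) (r : ℝ) :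
    circleAverage (fun ζ => ‖f ζ‖ ^ 2) c r
      = ‖f c‖ ^ 2 + circleAverage (fun ζ => ‖f ζ - f c‖ ^ 2) c r := by
  have hfc := hf.continuous
  have hexp : (fun ζ => ‖f ζ‖ ^ 2) = fun ζ => (‖f c‖ ^ 2 + ‖f ζ - f c‖ ^ 2)
      + Complex.reCLM (2 * (starRingEnd ℂ) (f c) * (f ζ - f c)) := by
    funext ζ
    simp only [← Complex.normSq_eq_norm_sq, Complex.normSq_apply, Complex.reCLM_apply,
      Complex.mul_re, Complex.mul_im, Complex.sub_re, Complex.sub_im, Complex.conj_re,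
      Complex.conj_im, Complex.re_ofNat, Complex.im_ofNat]
    ring
  have hint : ∀ g : ℂ → ℝ, Continuous g → CircleIntegrable g c r := fun g hg =>
    hg.continuousOn.circleIntegrable'
  have hzero : circleAverage (fun ζ => Complex.reCLM (2 * (starRingEnd ℂ) (f c) * (f ζ - f c))) c r
      = 0 := by
    have hd : Differentiable ℂ fun ζ => 2 * (starRingEnd ℂ) (f c) * (f ζ - f c) := by fun_prop
    have h := Complex.reCLM.circleAverage_comp_comm (f := fun ζ => 2 * (starRingEnd ℂ) (f c)
      * (f ζ - f c)) (c := c) (R := r) (hd.continuous.continuousOn.circleIntegrable')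
    have h2 := hd.diffContOnCl.circleAverage (c := c) (R := r)
    rw [h2] at h
    simpa [Function.comp_def] using h
  rw [hexp, circleAverage_fun_add (hint _ (by fun_prop)) (hint _ (by fun_prop)), hzero,
    circleAverage_fun_add (hint _ (by fun_prop)) (hint _ (by fun_prop)), circleAverage_const,
    add_zero]

/-! ### Maximum principle along holomorphic curves -/

/-- The doubled comparison function `h(ζ) - κ|ζ|² + N|p - φ(ζ)|²` cannot touch a plurisubharmonic
function from above when `h` has the mean value property. -/
theorem IsPSH.not_touches {Ω : Set (ℂ × ℂ)} (hΩ : IsOpen Ω) {u : ℂ × ℂ → EReal}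
    (hu : IsPSH u Ω) {φ : ℂ → ℂ × ℂ} (hφ : Differentiable ℂ φ) {h : ℂ → ℝ} {ζ₀ : ℂ} {p₀ : ℂ × ℂ}
    (hp₀ : p₀ ∈ Ω) {c κ N : ℝ} (hκ : 0 < κ) (hN : 0 ≤ N) (huc : u p₀ = (c : EReal))
    (hh : ∀ᶠ ζ in 𝓝 ζ₀, ContinuousAt h ζ)
    (hmean : ∀ᶠ r in 𝓝[>] (0 : ℝ), circleAverage h ζ₀ r = h ζ₀) {W : ℂ × (ℂ × ℂ) → ℝ}
    (hW : W = fun x => h x.1 - κ * ‖x.1‖ ^ 2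
      + N * (‖x.2.1 - (φ x.1).1‖ ^ 2 + ‖x.2.2 - (φ x.1).2‖ ^ 2))
    (hmax : ∀ᶠ x in 𝓝 (ζ₀, p₀), u x.2 ≤ ((c + (W x - W (ζ₀, p₀)) : ℝ) : EReal)) : False := by
  -- The loss from linearizing φ, at most 2Nη²r² on a circle of radius r, must stay below the gain
  -- κr².
  obtain ⟨η, hη, hηN⟩ : ∃ η > 0, N * (η ^ 2 + η ^ 2) < κ := by
    have ht : Tendsto (fun η : ℝ => N * (η ^ 2 + η ^ 2)) (𝓝[>] 0) (𝓝 (N * (0 ^ 2 + 0 ^ 2))) :=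
      (Continuous.tendsto (by fun_prop) 0).mono_left nhdsWithin_le_nhds
    obtain ⟨η, h1, h2⟩ := ((ht.eventually (gt_mem_nhds (by simpa using hκ))).and
      self_mem_nhdsWithin).exists
    exact ⟨η, h2, h1⟩
  -- Moving p along the complex line of direction φ'(ζ₀), in step with ζ, makes p - φ(ζ) holomorphic
  -- in ζ with zero derivative at ζ₀.
  set b := deriv φ ζ₀ with hb
  have hφ' : HasDerivAt φ b ζ₀ := (hφ ζ₀).hasDerivAt
  have hφ1 : Differentiable ℂ fun ζ => (φ ζ).1 := hφ.fst
  have hφ2 : Differentiable ℂ fun ζ => (φ ζ).2 := hφ.snd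
  set ℓ₁ : ℂ → ℂ := fun ζ => p₀.1 + (ζ - ζ₀) * b.1 - (φ ζ).1 with hℓ₁
  set ℓ₂ : ℂ → ℂ := fun ζ => p₀.2 + (ζ - ζ₀) * b.2 - (φ ζ).2 with hℓ₂
  have hd1 : Differentiable ℂ ℓ₁ := by fun_prop
  have hd2 : Differentiable ℂ ℓ₂ := by fun_prop
  have hc1 := hd1.continuous
  have hc2 := hd2.continuous
  have hsmall : ∀ᶠ ζ in 𝓝 ζ₀, ‖φ ζ - φ ζ₀ - (ζ - ζ₀) • b‖ ≤ η * ‖ζ - ζ₀‖ :=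
    (hasDerivAt_iff_isLittleO.1 hφ').bound hη
  have hline : ContinuousAt (fun ζ : ℂ => p₀ + (ζ - ζ₀) • b) ζ₀ := by fun_prop
  have hline0 : p₀ + (ζ₀ - ζ₀) • b = p₀ := by simp
  have hmem : ∀ᶠ ζ in 𝓝 ζ₀, p₀ + (ζ - ζ₀) • b ∈ Ω :=
    hline.eventually_mem (by rw [hline0]; exact hΩ.mem_nhds hp₀)
  have hmax' : ∀ᶠ ζ in 𝓝 ζ₀, u (p₀ + (ζ - ζ₀) • b)
      ≤ ((c + (W (ζ, p₀ + (ζ - ζ₀) • b) - W (ζ₀, p₀)) : ℝ) : EReal) := by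
    have hpair : Tendsto (fun ζ : ℂ => (ζ, p₀ + (ζ - ζ₀) • b)) (𝓝 ζ₀) (𝓝 (ζ₀, p₀)) := by
      have : ContinuousAt (fun ζ : ℂ => (ζ, p₀ + (ζ - ζ₀) • b)) ζ₀ := by fun_prop
      simpa [ContinuousAt] using this
    exact hpair.eventually hmax
  obtain ⟨R, hR, hball⟩ := Metric.eventually_nhds_iff_ball.1
    (hh.and (hsmall.and (hmem.and hmax')))
  obtain ⟨r, ⟨hrmean, hrR⟩, hr⟩ := ((hmean.and (nhdsWithin_le_nhds (gt_mem_nhds hR))).and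
    self_mem_nhdsWithin).exists
  have hr : 0 < r := hr
  have hsub : closedBall ζ₀ r ⊆ ball ζ₀ R := closedBall_subset_ball hrR
  have hsph : sphere ζ₀ r ⊆ closedBall ζ₀ r := sphere_subset_closedBall
  have habs : |r| = r := abs_of_pos hr
  set g : ℂ → ℝ := fun ζ => h ζ + ((c - W (ζ₀, p₀)) + (-κ) * ‖ζ‖ ^ 2
      + N * (‖ℓ₁ ζ‖ ^ 2 + ‖ℓ₂ ζ‖ ^ 2)) with hg
  have hgW : ∀ ζ, g ζ = c + (W (ζ, p₀ + (ζ - ζ₀) • b) - W (ζ₀, p₀)) := by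
    intro ζ
    simp only [hg, hW, hℓ₁, hℓ₂, Prod.fst_add, Prod.snd_add, Prod.smul_fst, Prod.smul_snd,
      smul_eq_mul]
    ring
  have hhc : ContinuousOn h (sphere ζ₀ r) := fun ζ hζ =>
    (hball ζ (hsub (hsph hζ))).1.continuousWithinAt
  have hle := hu.le_circleAverage (p := p₀) (b := b) (c := ζ₀) hr
    (fun ζ hζ => (hball ζ (hsub hζ)).2.2.1) (g := g)
    (hhc.add (Continuous.continuousOn (by fun_prop)))
    (fun ζ hζ => by rw [hgW]; exact (hball ζ (hsub (hsph hζ))).2.2.2)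
  rw [huc, EReal.coe_le_coe_iff] at hle
  have hint : ∀ g : ℂ → ℝ, Continuous g → CircleIntegrable g ζ₀ r := fun g hg =>
    hg.continuousOn.circleIntegrable'
  have hh_int : CircleIntegrable h ζ₀ r := hhc.circleIntegrable hr.le
  have hrem : ∀ ℓ : ℂ → ℂ, Differentiable ℂ ℓ →
      (∀ ζ ∈ sphere ζ₀ r, ‖ℓ ζ - ℓ ζ₀‖ ≤ η * r) →
      circleAverage (fun ζ => ‖ℓ ζ‖ ^ 2) ζ₀ r ≤ ‖ℓ ζ₀‖ ^ 2 + (η * r) ^ 2 := by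
    intro ℓ hd hb
    have hc := hd.continuous
    rw [circleAverage_norm_sq hd]
    gcongr
    refine circleAverage_mono_on_of_le_circle (hint _ (by fun_prop)) fun ζ hζ => ?_
    rw [habs] at hζ
    exact pow_le_pow_left₀ (norm_nonneg _) (hb ζ hζ) 2
  have h1 := hrem ℓ₁ hd1 (fun ζ hζ => by
    have h := (hball ζ (hsub (hsph hζ))).2.1
    rw [mem_sphere_iff_norm.1 hζ] at h
    refine le_trans ?_ ((norm_fst_le _).trans h)
    rw [← norm_neg]
    apply le_of_eq
    congr 1
    simp [hℓ₁]; ring)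
  have h2 := hrem ℓ₂ hd2 (fun ζ hζ => by
    have h := (hball ζ (hsub (hsph hζ))).2.1
    rw [mem_sphere_iff_norm.1 hζ] at h
    refine le_trans ?_ ((norm_snd_le _).trans h)
    rw [← norm_neg]
    apply le_of_eq
    congr 1
    simp [hℓ₂]; ring)
  have h3 : circleAverage (fun ζ : ℂ => ‖ζ‖ ^ 2) ζ₀ r = ‖ζ₀‖ ^ 2 + r ^ 2 := by
    rw [circleAverage_norm_sq differentiable_fun_id]
    congr 1
    refine circleAverage_const_on_circle fun ζ hζ => ?_
    rw [habs] at hζ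
    rw [mem_sphere_iff_norm.1 hζ]
  have hκavg := circleAverage_fun_smul (a := -κ) (f := fun ζ : ℂ => ‖ζ‖ ^ 2) (c := ζ₀) (R := r)
  have hNavg := circleAverage_fun_smul (a := N) (f := fun ζ : ℂ => ‖ℓ₁ ζ‖ ^ 2 + ‖ℓ₂ ζ‖ ^ 2)
    (c := ζ₀) (R := r)
  simp only [smul_eq_mul] at hκavg hNavg
  rw [hg, circleAverage_fun_add hh_int (hint _ (by fun_prop)),
    circleAverage_fun_add (hint _ (by fun_prop)) (hint _ (by fun_prop)),
    circleAverage_fun_add (hint _ (by fun_prop)) (hint _ (by fun_prop)), hκavg, hNavg,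
    circleAverage_fun_add (hint _ (by fun_prop)) (hint _ (by fun_prop)), circleAverage_const,
    hrmean, h3] at hle
  have hW0 : W (ζ₀, p₀) = h ζ₀ - κ * ‖ζ₀‖ ^ 2 + N * (‖ℓ₁ ζ₀‖ ^ 2 + ‖ℓ₂ ζ₀‖ ^ 2) := by
    simp [hW, hℓ₁, hℓ₂]
  have h4 : N * (circleAverage (fun ζ => ‖ℓ₁ ζ‖ ^ 2) ζ₀ r + circleAverage (fun ζ => ‖ℓ₂ ζ‖ ^ 2) ζ₀ r)
      ≤ N * ((‖ℓ₁ ζ₀‖ ^ 2 + (η * r) ^ 2) + (‖ℓ₂ ζ₀‖ ^ 2 + (η * r) ^ 2)) := by gcongr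
  have h5 : N * (η ^ 2 + η ^ 2) * r ^ 2 < κ * r ^ 2 := by gcongr
  rw [hW0] at hle
  nlinarith

/-- The touching point maximizes v - W on the compact set; the value there is finite because it is
at least c - W y. -/
theorem UpperSemicontinuousOn.exists_touching_coe {X : Type*} [TopologicalSpace X] {s : Set X}
    (hs : IsCompact s) {v : X → EReal} (hv : UpperSemicontinuousOn v s) (htop : ∀ x ∈ s, v x < ⊤)
    {W : X → ℝ} (hW : ContinuousOn W s) {y : X} (hy : y ∈ s) {c : ℝ} (hc : v y = c) :
    ∃ x ∈ s, ∃ d : ℝ, v x = d ∧ c - W y ≤ d - W x ∧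
      ∀ z ∈ s, v z ≤ ((d + (W z - W x) : ℝ) : EReal) := by
  have husc : UpperSemicontinuousOn (fun x => v x + ((-W x : ℝ) : EReal)) s := by
    refine UpperSemicontinuousOn.add' hv ?_ ?_
    · exact ((continuous_coe_real_ereal.comp_continuousOn hW.neg)).upperSemicontinuousOn
    · intro x hx
      exact EReal.continuousAt_add (Or.inl (htop x hx).ne) (Or.inr (EReal.coe_ne_top _))
  obtain ⟨x, hx, hmax⟩ := husc.exists_isMaxOn ⟨y, hy⟩ hs
  have hyx : v y + ((-W y : ℝ) : EReal) ≤ v x + ((-W x : ℝ) : EReal) := hmax hy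
  have hbot : v x ≠ ⊥ := by
    intro h
    rw [h, EReal.bot_add, hc, ← EReal.coe_add, le_bot_iff] at hyx
    exact EReal.coe_ne_bot _ hyx
  lift v x to ℝ using ⟨(htop x hx).ne, hbot⟩ with d hd
  refine ⟨x, hx, d, hd.symm, ?_, fun z hz => ?_⟩
  · rw [hc, ← EReal.coe_add, ← EReal.coe_add, EReal.coe_le_coe_iff] at hyx
    linarith
  · have hzx : v z + ((-W z : ℝ) : EReal) ≤ v x + ((-W x : ℝ) : EReal) := hmax hz
    rw [← hd] at hzx
    induction hvz : v z with
    | bot => exact bot_le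
    | top => exact absurd hvz (htop z hz).ne
    | coe e =>
      rw [hvz, ← EReal.coe_add, ← EReal.coe_add, EReal.coe_le_coe_iff] at hzx
      rw [EReal.coe_le_coe_iff]
      linarith

/-- The maximum principle for a nonpositive plurisubharmonic function along a holomorphic curve. -/
theorem IsPSH.comp_le {Ω : Set (ℂ × ℂ)} (hΩ : IsOpen Ω) {u : ℂ × ℂ → EReal}
    (hu : IsPSH u Ω) (hu0 : ∀ p ∈ Ω, u p ≤ 0) {φ : ℂ → ℂ × ℂ} (hφ : Differentiable ℂ φ)
    {K : Set ℂ} (hK : IsCompact K) (hKΩ : ∀ ζ ∈ K, φ ζ ∈ Ω) {h : ℂ → ℝ} (hh : ContinuousOn h K)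
    (hmean : ∀ ζ, K ∈ 𝓝 ζ → ∀ᶠ r in 𝓝[>] (0 : ℝ), circleAverage h ζ r = h ζ)
    (hbd : ∀ ζ ∈ K, K ∈ 𝓝 ζ ∨ u (φ ζ) ≤ h ζ) {s : ℂ} (hs : s ∈ K) : u (φ s) ≤ h s := by
  by_contra hlt
  rw [not_le] at hlt
  obtain ⟨c, hc⟩ : ∃ c : ℝ, u (φ s) = c :=
    ⟨_, (EReal.coe_toReal (hu.lt_top _ (hKΩ s hs)).ne (bot_le.trans_lt hlt).ne').symm⟩
  rw [hc, EReal.coe_lt_coe_iff] at hlt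
  obtain ⟨B, hB⟩ : ∃ B : ℝ, ∀ ζ ∈ K, ‖ζ‖ ^ 2 ≤ B := by
    obtain ⟨B, hB⟩ := hK.exists_bound_of_continuousOn (f := fun ζ : ℂ => ‖ζ‖ ^ 2)
      (by fun_prop)
    exact ⟨B, fun ζ hζ => (le_norm_self _).trans (hB ζ hζ)⟩
  have hB0 : 0 ≤ B := (sq_nonneg _).trans (hB s hs)
  -- The penalty κ|ζ|² stays below the excess c - h(s) on all of K.
  set κ : ℝ := (c - h s) / (B + 1) with hκ
  have hκ0 : 0 < κ := div_pos (by linarith) (by linarith)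
  have hκB : κ * B < c - h s := by
    have : κ * (B + 1) = c - h s := by rw [hκ]; field_simp
    linarith
  have hφc := hφ.continuous
  obtain ⟨ρ, hρ, hρΩ⟩ := (hK.image hφc).exists_cthickening_subset_open hΩ
    (by rintro _ ⟨ζ, hζ, rfl⟩; exact hKΩ ζ hζ)
  set P := cthickening ρ (φ '' K) with hP
  have hPc : IsCompact P := (hK.image hφc).cthickening
  have hφP : ∀ ζ ∈ K, P ∈ 𝓝 (φ ζ) := fun ζ hζ =>
    mem_of_superset (isOpen_thickening.mem_nhds
      (self_subset_thickening hρ _ (mem_image_of_mem φ hζ))) (thickening_subset_cthickening _ _)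
  set W : ℕ → ℂ × (ℂ × ℂ) → ℝ := fun n x => h x.1 - κ * ‖x.1‖ ^ 2
      + n * (‖x.2.1 - (φ x.1).1‖ ^ 2 + ‖x.2.2 - (φ x.1).2‖ ^ 2) with hW
  have hWs : ∀ n, W n (s, φ s) = h s - κ * ‖s‖ ^ 2 := by intro n; simp [hW]
  have hWc : ∀ n, ContinuousOn (W n) (K ×ˢ P) := by
    intro n
    have h1 : ContinuousOn (fun x : ℂ × (ℂ × ℂ) => h x.1) (K ×ˢ P) :=
      hh.comp continuousOn_fst fun x hx => hx.1
    have h2 : Continuous fun x : ℂ × (ℂ × ℂ) => κ * ‖x.1‖ ^ 2 := by fun_prop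
    have h3 : Continuous fun x : ℂ × (ℂ × ℂ) =>
      n * (‖x.2.1 - (φ x.1).1‖ ^ 2 + ‖x.2.2 - (φ x.1).2‖ ^ 2) := by fun_prop
    exact (h1.sub h2.continuousOn).add h3.continuousOn
  have hex : ∀ n : ℕ, ∃ x ∈ K ×ˢ P, ∃ d : ℝ, u x.2 = d ∧ c - W n (s, φ s) ≤ d - W n x ∧
      ∀ z ∈ K ×ˢ P, u z.2 ≤ ((d + (W n z - W n x) : ℝ) : EReal) := fun n =>
    UpperSemicontinuousOn.exists_touching_coe (hK.prod hPc) (v := fun x => u x.2)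
      ((hu.usc.mono hρΩ).comp continuousOn_snd fun x hx => hx.2)
      (fun x hx => hu.lt_top _ (hρΩ hx.2)) (hWc n)
      (y := (s, φ s)) ⟨hs, mem_of_mem_nhds (hφP s hs)⟩ hc
  choose x hx d hd hdc hmax using hex
  obtain ⟨y, hy, σ, hσ, hlim⟩ := (hK.prod hPc).tendsto_subseq hx
  have hlim1 : Tendsto (fun n => (x (σ n)).1) atTop (𝓝 y.1) := (continuous_fst.tendsto y).comp hlim
  have hlim2 : Tendsto (fun n => (x (σ n)).2) atTop (𝓝 y.2) := (continuous_snd.tendsto y).comp hlim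
  have hd0 : ∀ n, d n ≤ 0 := fun n => by
    have := hu0 _ (hρΩ (hx n).2)
    rw [hd n] at this
    exact_mod_cast this
  set Q : ℂ × (ℂ × ℂ) → ℝ := fun x => ‖x.2.1 - (φ x.1).1‖ ^ 2 + ‖x.2.2 - (φ x.1).2‖ ^ 2 with hQ
  have hQ0 : ∀ x, 0 ≤ Q x := fun x => by positivity
  have hlow : ∀ n, c - h s + h (x n).1 - κ * B + n * Q (x n) ≤ d n := by
    intro n
    have h1 := hdc n
    have h2 : W n (x n) = h (x n).1 - κ * ‖(x n).1‖ ^ 2 + n * Q (x n) := rfl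
    have h3 : κ * ‖(x n).1‖ ^ 2 ≤ κ * B := by gcongr; exact hB _ (hx n).1
    have h4 : 0 ≤ κ * ‖s‖ ^ 2 := by positivity
    rw [hWs] at h1
    linarith
  have hhlim : Tendsto (fun n => h (x (σ n)).1) atTop (𝓝 (h y.1)) :=
    (hh y.1 hy.1).tendsto.comp (tendsto_nhdsWithin_iff.2
      ⟨hlim1, Eventually.of_forall fun n => (hx (σ n)).1⟩)
  have hQlim : Tendsto (fun n => Q (x (σ n))) atTop (𝓝 (Q y)) := by
    have : Continuous Q := by fun_prop
    exact (this.tendsto y).comp hlim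
  -- Since u ≤ 0 bounds the touching values above, n·Q stays bounded along the subsequence, so the
  -- limit point lies on the graph of φ.
  have hQy : Q y = 0 := by
    by_contra hne
    have hpos : 0 < Q y := lt_of_le_of_ne (hQ0 y) (Ne.symm hne)
    have htop : Tendsto (fun n => (σ n : ℝ) * Q (x (σ n))) atTop atTop :=
      (tendsto_natCast_atTop_atTop.comp hσ.tendsto_atTop).atTop_mul_pos hpos hQlim
    have hsum := htop.atTop_add (hhlim.add_const (c - h s - κ * B))
    obtain ⟨n, hn⟩ := (hsum.eventually_gt_atTop 0).exists
    have h1 := hlow (σ n)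
    have h2 := hd0 (σ n)
    linarith
  have hyφ : y.2 = φ y.1 := by
    have h1 : ‖y.2.1 - (φ y.1).1‖ ^ 2 = 0 ∧ ‖y.2.2 - (φ y.1).2‖ ^ 2 = 0 :=
      (add_eq_zero_iff_of_nonneg (by positivity) (by positivity)).1 hQy
    simp only [ne_eq, OfNat.ofNat_ne_zero, not_false_eq_true, pow_eq_zero_iff, norm_eq_zero,
      sub_eq_zero] at h1
    exact Prod.ext h1.1 h1.2
  -- Upper semicontinuity carries the excess to the limit point. The boundary alternative fails
  -- there, so the touching points are eventually interior and `IsPSH.not_touches` applies.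
  have hgt : ((h y.1 : ℝ) : EReal) < u (φ y.1) := by
    obtain ⟨m, hm1, hm2⟩ : ∃ m : ℝ, h y.1 < m ∧ m < c - h s + h y.1 - κ * B :=
      exists_between (by linarith)
    refine lt_of_lt_of_le (EReal.coe_lt_coe_iff.2 hm1) ?_
    by_contra hcon
    rw [not_le, ← hyφ] at hcon
    have h1 : ∀ᶠ n in atTop, u (x (σ n)).2 < m :=
      (tendsto_nhdsWithin_iff.2 ⟨hlim2, Eventually.of_forall fun n => hρΩ (hx (σ n)).2⟩).eventually
        (hu.usc y.2 (hρΩ hy.2) m hcon)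
    have h2 : ∀ᶠ n in atTop, m < c - h s + h (x (σ n)).1 - κ * B :=
      ((hhlim.const_add (c - h s)).sub_const (κ * B)).eventually (lt_mem_nhds hm2)
    obtain ⟨n, h3, h4⟩ := (h1.and h2).exists
    rw [hd, EReal.coe_lt_coe_iff] at h3
    have h5 := hlow (σ n)
    have h6 : 0 ≤ (σ n : ℝ) * Q (x (σ n)) := mul_nonneg (Nat.cast_nonneg _) (hQ0 _)
    linarith
  have hKy : K ∈ 𝓝 y.1 := (hbd y.1 hy.1).resolve_right (not_le.2 hgt)
  obtain ⟨n, hn1, hn2⟩ := ((hlim1.eventually (eventually_mem_nhds_iff.2 hKy)).and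
    (hlim2.eventually (eventually_mem_nhds_iff.2 (hyφ ▸ hφP y.1 hy.1)))).exists
  refine hu.not_touches hΩ hφ (hρΩ (hx (σ n)).2) hκ0 (Nat.cast_nonneg (σ n)) (hd (σ n)) ?_
    (hmean _ hn1) (W := W (σ n)) rfl ?_
  · filter_upwards [eventually_mem_nhds_iff.2 hn1] with ζ hζ using hh.continuousAt hζ
  · filter_upwards [prod_mem_nhds hn1 hn2] with z hz using hmax (σ n) z hz

/-! ### Comparison with logarithmic poles on analytic disks -/

theorem isOpen_bidisk : IsOpen bidisk := isOpen_ball.prod isOpen_ball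

/-- A competitor has a logarithmic pole along any holomorphic curve passing through the pole set. -/
theorem IsCompetitor.exists_comp_le_log {Ω S : Set (ℂ × ℂ)} (hΩ : IsOpen Ω)
    {u : ℂ × ℂ → EReal} (hu : IsCompetitor (vanishingIdeal Ω S) u) {φ : ℂ → ℂ × ℂ} {a : ℂ}
    (hφ : DifferentiableAt ℂ φ a) (haΩ : φ a ∈ Ω) (haS : φ a ∈ S) :
    ∃ C : ℝ, ∀ᶠ ζ in 𝓝[≠] a, u (φ ζ) ≤ ((log ‖ζ - a‖ + C : ℝ) : EReal) := by
  obtain ⟨-, -, m, ψ, hspan, hloc⟩ := hu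
  have hψ : ∀ j, (ψ j).1 ⟨φ a, haΩ⟩ = 0 := fun j => by
    have h : ψ j ∈ vanishingIdeal Ω S := hspan ▸ Ideal.subset_span (mem_range_self j)
    exact h ⟨φ a, haΩ⟩ haS
  obtain ⟨C, hC⟩ := hloc ⟨φ a, haΩ⟩ fun f hf => hf _ haS
  have hlip : ∀ j, ∃ L : ℝ, ∀ᶠ ζ in 𝓝 a, ∀ hζ : φ ζ ∈ Ω, ‖(ψ j).1 ⟨φ ζ, hζ⟩‖ ≤ L * ‖ζ - a‖ := by
    intro j
    obtain ⟨F, hF, hFψ⟩ := (ψ j).2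
    have hd : DifferentiableAt ℂ (fun ζ => F (φ ζ)) a :=
      ((hF _ haΩ).differentiableAt (hΩ.mem_nhds haΩ)).comp a hφ
    obtain ⟨L, hL⟩ := hd.isBigO_sub.bound
    refine ⟨L, hL.mono fun ζ h hζ => ?_⟩
    have h0 : F (φ a) = 0 := (hFψ ⟨φ a, haΩ⟩).trans (hψ j)
    rw [← hFψ ⟨φ ζ, hζ⟩]
    simpa [h0] using h
  choose L hL using hlip
  -- The summand 1 keeps M positive even for an empty family of generators.
  set M : ℝ := ∑ j, |L j| + 1 with hM
  have hM0 : 0 < M := by positivity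
  have hLM : ∀ j, L j ≤ M := fun j =>
    (le_abs_self _).trans ((Finset.single_le_sum (f := fun j => |L j|) (fun i _ => abs_nonneg _)
      (Finset.mem_univ j)).trans (by simp [hM]))
  refine ⟨log M + C, ?_⟩
  have hmem : ∀ᶠ ζ in 𝓝 a, φ ζ ∈ Ω := hφ.continuousAt.eventually_mem (hΩ.mem_nhds haΩ)
  have hC' : ∀ᶠ ζ in 𝓝 a, ∀ hζ : φ ζ ∈ Ω, u (φ ζ) ≤ maxLog ψ ⟨φ ζ, hζ⟩ + (C : EReal) := by
    rw [nhds_subtype, eventually_comap] at hC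
    exact (hφ.continuousAt.eventually hC).mono fun ζ h hζ => h ⟨φ ζ, hζ⟩ rfl
  filter_upwards [nhdsWithin_le_nhds hmem, nhdsWithin_le_nhds hC',
    nhdsWithin_le_nhds (eventually_all.2 hL), self_mem_nhdsWithin] with ζ h1 h2 h3 h4
  have hpos : 0 < ‖ζ - a‖ := norm_pos_iff.2 (sub_ne_zero.2 h4)
  have hmax : maxLog ψ ⟨φ ζ, h1⟩ ≤ ((log (M * ‖ζ - a‖) : ℝ) : EReal) := by
    refine iSup_le fun j => ?_
    rw [← ENNReal.log_ofReal_of_pos (by positivity)]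
    refine ENNReal.log_monotone ?_
    rw [← ofReal_norm]
    refine ENNReal.ofReal_le_ofReal ((h3 j h1).trans ?_)
    gcongr
    exact hLM j
  refine (h2 h1).trans ((add_le_add_left hmax _).trans ?_)
  rw [← EReal.coe_add, EReal.coe_le_coe_iff, log_mul hM0.ne' hpos.ne']
  linarith

/-- A sum of logarithmic poles in the unit disk, normalized to be nonnegative on the circle. -/
noncomputable def logPoles (A : Finset ℂ) (ζ : ℂ) : ℝ := ∑ a ∈ A, (log ‖ζ - a‖ - log (1 - ‖a‖))

theorem logPoles_nonneg {A : Finset ℂ} (hA : ∀ a ∈ A, ‖a‖ < 1) {ζ : ℂ} (hζ : ‖ζ‖ = 1) :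
    0 ≤ logPoles A ζ := by
  refine Finset.sum_nonneg fun a ha => sub_nonneg.2 (log_le_log (sub_pos.2 (hA a ha)) ?_)
  have := norm_sub_norm_le ζ a
  rwa [hζ] at this

theorem continuousAt_logPoles {A : Finset ℂ} {ζ : ℂ} (hζ : ζ ∉ A) :
    ContinuousAt (logPoles A) ζ := by
  unfold logPoles
  refine tendsto_finsetSum _ fun a ha => ?_
  have hne : ‖ζ - a‖ ≠ 0 := norm_ne_zero_iff.2 (sub_ne_zero.2 fun h => hζ (h ▸ ha))
  have h1 : ContinuousAt (fun ζ : ℂ => ‖ζ - a‖) ζ := by fun_prop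
  exact (h1.log hne).sub continuousAt_const

theorem circleAverage_logPoles {A : Finset ℂ} {ζ : ℂ} (hζ : ζ ∉ A) :
    ∀ᶠ r in 𝓝[>] (0 : ℝ), circleAverage (logPoles A) ζ r = logPoles A ζ := by
  have hne : ∀ᶠ ξ in 𝓝 ζ, ξ ∉ A :=
    A.finite_toSet.isClosed.isOpen_compl.mem_nhds hζ
  obtain ⟨R, hR, hball⟩ := Metric.eventually_nhds_iff_ball.1 hne
  filter_upwards [Ioo_mem_nhdsGT hR] with r hr
  have hsub : closedBall ζ |r| ⊆ ball ζ R :=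
    closedBall_subset_ball (by rw [abs_of_pos hr.1]; exact hr.2)
  have hav : ∀ a ∈ A, circleAverage (fun ξ => log ‖ξ - a‖) ζ r = log ‖ζ - a‖ := fun a ha =>
    AnalyticOnNhd.circleAverage_log_norm_of_ne_zero (g := fun ξ => ξ - a)
      (fun ξ _ => by fun_prop) fun ξ hξ => sub_ne_zero.2 fun h => hball ξ (hsub hξ) (h ▸ ha)
  have hint : ∀ a ∈ A, CircleIntegrable (fun ξ => log ‖ξ - a‖) ζ r := fun a ha =>
    ContinuousOn.circleIntegrable' fun ξ hξ => by
      have hne : ‖ξ - a‖ ≠ 0 := norm_ne_zero_iff.2 (sub_ne_zero.2 fun h =>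
        hball ξ (hsub (sphere_subset_closedBall hξ)) (h ▸ ha))
      have h1 : ContinuousAt (fun ζ : ℂ => ‖ζ - a‖) ξ := by fun_prop
      exact (h1.log hne).continuousWithinAt
  have hint' : ∀ a ∈ A, CircleIntegrable (fun ξ => log ‖ξ - a‖ - log (1 - ‖a‖)) ζ r :=
    fun a ha => (hint a ha).sub (circleIntegrable_const _ _ _)
  unfold logPoles
  rw [circleAverage_fun_sum hint']
  refine Finset.sum_congr rfl fun a ha => ?_
  rw [circleAverage_fun_sub (hint a ha) (circleIntegrable_const _ _ _), hav a ha,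
    circleAverage_const]

/-- Near a pole, a logarithmic pole of weight one lies below one of smaller weight. -/
theorem eventually_log_add_le_mul_logPoles {A : Finset ℂ} {a : ℂ} (ha : a ∈ A) (C : ℝ) {k : ℝ}
    (hk0 : 0 < k) (hk : k < 1) :
    ∀ᶠ ζ in 𝓝[≠] a, log ‖ζ - a‖ + C ≤ k * logPoles A ζ := by
  classical
  have hsplit : ∀ ζ, logPoles A ζ
      = log ‖ζ - a‖ + (logPoles (A.erase a) ζ - log (1 - ‖a‖)) := by
    intro ζ
    unfold logPoles
    rw [← Finset.add_sum_erase A _ ha]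
    ring
  have hG : ContinuousAt (logPoles (A.erase a)) a := continuousAt_logPoles (by simp)
  have h1 : ∀ᶠ ζ in 𝓝[≠] a, logPoles (A.erase a) a - 1 < logPoles (A.erase a) ζ :=
    nhdsWithin_le_nhds (hG.eventually (lt_mem_nhds (by linarith)))
  have hlog : Tendsto (fun ζ : ℂ => log ‖ζ - a‖) (𝓝[≠] a) atBot :=
    tendsto_log_nhdsNE_zero.comp <| tendsto_nhdsWithin_iff.2
      ⟨by
        have h : ContinuousAt (fun ζ : ℂ => ‖ζ - a‖) a := by fun_prop
        simpa using h.tendsto.mono_left nhdsWithin_le_nhds,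
      eventually_mem_nhdsWithin.mono fun ζ hζ => norm_ne_zero_iff.2 (sub_ne_zero.2 hζ)⟩
  have h2 := (hlog.const_mul_atBot (sub_pos.2 hk)).eventually_le_atBot
    (k * (logPoles (A.erase a) a - 1 - log (1 - ‖a‖)) - C)
  filter_upwards [h1, h2] with ζ h3 h4
  rw [hsplit]
  nlinarith

/-- Upper bound for a competitor along a closed analytic disk passing through the poles. -/
theorem IsCompetitor.le_logPoles {Ω S : Set (ℂ × ℂ)} (hΩ : IsOpen Ω) {u : ℂ × ℂ → EReal}
    (hu : IsCompetitor (vanishingIdeal Ω S) u) {φ : ℂ → ℂ × ℂ} (hφ : Differentiable ℂ φ)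
    (hφΩ : ∀ ζ, ‖ζ‖ ≤ 1 → φ ζ ∈ Ω) {A : Finset ℂ} (hA : ∀ a ∈ A, ‖a‖ < 1)
    (hAS : ∀ a ∈ A, φ a ∈ S) {s : ℂ} (hs : ‖s‖ ≤ 1) (hsA : s ∉ A) :
    u (φ s) ≤ (logPoles A s : ℝ) := by
  by_contra hlt
  rw [not_le] at hlt
  obtain ⟨c, hc⟩ : ∃ c : ℝ, u (φ s) = c :=
    ⟨_, (EReal.coe_toReal (hu.1.lt_top _ (hφΩ s hs)).ne (bot_le.trans_lt hlt).ne').symm⟩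
  rw [hc, EReal.coe_lt_coe_iff] at hlt
  -- A weight k < 1 lets the pole of the comparison function absorb the O(1) term; the strict
  -- inequality at s survives for k near 1.
  obtain ⟨k, hk0, hk1, hkc⟩ : ∃ k : ℝ, 0 < k ∧ k < 1 ∧ k * logPoles A s < c := by
    have ht : Tendsto (fun k : ℝ => k * logPoles A s) (𝓝[<] 1) (𝓝 (1 * logPoles A s)) :=
      (Continuous.tendsto (by fun_prop) 1).mono_left nhdsWithin_le_nhds
    obtain ⟨k, h1, h2⟩ := ((ht.eventually (gt_mem_nhds (by simpa using hlt))).and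
      (Ioo_mem_nhdsLT (zero_lt_one (α := ℝ)))).exists
    exact ⟨k, h2.1, h2.2, h1⟩
  have hpole : ∀ a ∈ A, ∀ᶠ r in 𝓝[>] (0 : ℝ),
      ∀ ζ, ζ ≠ a → ‖ζ - a‖ ≤ r → u (φ ζ) ≤ ((k * logPoles A ζ : ℝ) : EReal) := by
    intro a ha
    obtain ⟨C, hC⟩ := hu.exists_comp_le_log hΩ (hφ a) (hφΩ a (hA a ha).le) (hAS a ha)
    have h := hC.and (eventually_log_add_le_mul_logPoles ha C hk0 hk1)
    rw [eventually_nhdsWithin_iff, Metric.eventually_nhds_iff_ball] at h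
    obtain ⟨R, hR, hball⟩ := h
    filter_upwards [Ioo_mem_nhdsGT hR] with r hr ζ hζa hζ
    obtain ⟨h1, h2⟩ := hball ζ (mem_ball_iff_norm.2 (hζ.trans_lt hr.2)) hζa
    exact h1.trans (EReal.coe_le_coe_iff.2 h2)
  have hsr : ∀ a ∈ A, ∀ᶠ r in 𝓝[>] (0 : ℝ), r ≤ ‖s - a‖ := fun a ha =>
    nhdsWithin_le_nhds (ge_mem_nhds (norm_pos_iff.2 (sub_ne_zero.2 fun h => hsA (h ▸ ha))))
  obtain ⟨r, ⟨h1, h2⟩, hr⟩ := ((((Finset.eventually_all A).2 hpole).and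
    ((Finset.eventually_all A).2 hsr)).and self_mem_nhdsWithin).exists
  have hr : 0 < r := hr
  -- The closed unit disk with small disks around the poles removed: the comparison function is
  -- harmonic inside and dominates u ∘ φ on the boundary.
  set K : Set ℂ := {ζ | ‖ζ‖ ≤ 1 ∧ ∀ a ∈ A, r ≤ ‖ζ - a‖} with hKdef
  have hKA : ∀ ζ ∈ K, ζ ∉ A := by
    intro ζ hζ hmem
    have := hζ.2 ζ hmem
    simp only [sub_self, norm_zero] at this
    linarith
  have hK : IsCompact K := by
    refine (isCompact_closedBall (0 : ℂ) 1).of_isClosed_subset ?_ fun ζ hζ => by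
      simpa using hζ.1
    have hset : K = {ζ : ℂ | ‖ζ‖ ≤ 1} ∩ ⋂ a ∈ A, {ζ : ℂ | r ≤ ‖ζ - a‖} := by
      ext ζ; simp [hKdef]
    rw [hset]
    exact (isClosed_le (by fun_prop) (by fun_prop)).inter
      (isClosed_biInter fun a _ => isClosed_le (by fun_prop) (by fun_prop))
  have hle := hu.1.comp_le hΩ hu.2.1 hφ hK (fun ζ hζ => hφΩ ζ hζ.1)
    (h := fun ζ => k * logPoles A ζ)
    (fun ζ hζ => ((continuousAt_logPoles (hKA ζ hζ)).const_mul k).continuousWithinAt)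
    (fun ζ hζ => by
      filter_upwards [circleAverage_logPoles (hKA ζ (mem_of_mem_nhds hζ))] with ρ hρ
      have := circleAverage_fun_smul (a := k) (f := logPoles A) (c := ζ) (R := ρ)
      simp only [smul_eq_mul] at this
      rw [this, hρ])
    (fun ζ hζ => by
      by_cases hn : ‖ζ‖ = 1
      · right
        refine (hu.2.1 _ (hφΩ ζ hζ.1)).trans ?_
        exact_mod_cast mul_nonneg hk0.le (logPoles_nonneg hA hn)
      by_cases ha : ∃ a ∈ A, ‖ζ - a‖ ≤ r
      · obtain ⟨a, ha, har⟩ := ha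
        exact Or.inr (h1 a ha ζ (fun h => hKA ζ hζ (h ▸ ha)) har)
      · left
        push Not at ha
        have e1 : ∀ᶠ ξ : ℂ in 𝓝 ζ, ‖ξ‖ ≤ 1 :=
          (continuous_norm.tendsto ζ).eventually (ge_mem_nhds (lt_of_le_of_ne hζ.1 hn) |>.mono
            fun _ h => h)
        have e2 : ∀ a ∈ A, ∀ᶠ ξ : ℂ in 𝓝 ζ, r ≤ ‖ξ - a‖ := fun a haA =>
          (Continuous.tendsto (f := fun ξ : ℂ => ‖ξ - a‖) (by fun_prop) ζ).eventually
            (le_mem_nhds (ha a haA))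
        exact e1.and ((Finset.eventually_all A).2 e2))
    (s := s) ⟨hs, h2⟩
  rw [hc, EReal.coe_le_coe_iff] at hle
  linarith

/-- Upper bound for the Green function on an analytic disk passing through the poles. -/
theorem greenSet_le_logPoles {Ω S : Set (ℂ × ℂ)} (hΩ : IsOpen Ω) {φ : ℂ → ℂ × ℂ}
    (hφ : Differentiable ℂ φ) (hφΩ : ∀ ζ, ‖ζ‖ ≤ 1 → φ ζ ∈ Ω) {A : Finset ℂ}
    (hA : ∀ a ∈ A, ‖a‖ < 1) (hAS : ∀ a ∈ A, φ a ∈ S) {s : ℂ} (hs : ‖s‖ ≤ 1) (hsA : s ∉ A) :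
    greenSet Ω S (φ s) ≤ (logPoles A s : ℝ) := by
  refine sSup_le ?_
  rintro _ ⟨u, hu, rfl⟩
  exact hu.le_logPoles hΩ hφ hφΩ hA hAS hs hsA

/-! ### Conics through the three poles -/

/-- A conic disk `ζ ↦ ζ (ζ v + w)` with prescribed leading coefficient through the three poles. -/
theorem exists_conic_through_threePoints {v₁ v₂ ε ρ δ : ℂ} (hv₂ : v₂ ≠ 0) (hε : ε ≠ 0)
    (hρ : ρ ≠ 0) (hδ : δ ≠ 0) (h1 : ‖ρ‖ ≤ ‖ε‖) (h2 : ‖ρ‖ ≤ ‖ε - ρ‖)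
    (hk : ‖v₁ / v₂ * δ‖ ≤ 1 / 4) :
    ∃ α β w₁ w₂ : ℂ, α ≠ 0 ∧ β ≠ 0 ∧ α ≠ β ∧
      α * (v₁ * α + w₁) = ε ∧ α * (v₂ * α + w₂) = 0 ∧
      β * (v₁ * β + w₁) = ρ ∧ β * (v₂ * β + w₂) = δ * ρ ∧
      ‖α‖ ^ 2 ≤ 6 * ‖δ‖ * ‖ε‖ / ‖v₂‖ ∧ ‖β‖ ≤ 2 * ‖α‖ ∧ ‖w₂‖ = ‖v₂‖ * ‖α‖ ∧
      ∃ q : ℂ, ‖q‖ ^ 2 ≤ 4 * ‖v₂‖ * ‖ε‖ / ‖δ‖ ∧ ‖w₁‖ ≤ ‖q‖ + ‖v₁‖ * ‖α‖ := by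
  set k := v₁ / v₂ with hkdef
  have hv₁ : v₁ = k * v₂ := by rw [hkdef]; field_simp
  set e := 1 - k * δ with he
  set D := (ρ - ε) - k * δ * ρ with hD
  have hεn : 0 < ‖ε‖ := norm_pos_iff.2 hε
  have hδn : 0 < ‖δ‖ := norm_pos_iff.2 hδ
  have hvn : 0 < ‖v₂‖ := norm_pos_iff.2 hv₂
  have he1 : 3 / 4 ≤ ‖e‖ := by
    have := norm_sub_norm_le 1 (k * δ)
    rw [norm_one] at this
    linarith
  have he2 : ‖e‖ ≤ 5 / 4 := by
    have := norm_sub_le 1 (k * δ)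
    rw [norm_one] at this
    linarith
  have hkρ : ‖k * δ * ρ‖ ≤ ‖ε‖ / 4 := by
    rw [norm_mul]
    have : ‖k * δ‖ * ‖ρ‖ ≤ 1 / 4 * ‖ε‖ := by gcongr
    linarith
  have hερ : ‖ε‖ ≤ ‖ε - ρ‖ + ‖ρ‖ := by simpa using norm_add_le (ε - ρ) ρ
  -- The two bounds on |ρ| give |ε - ρ| ≥ |ε|/2; the term kδρ costs at most |ε|/4.
  have hD1 : ‖ε‖ / 4 ≤ ‖D‖ := by
    have := norm_sub_norm_le (ρ - ε) (k * δ * ρ)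
    rw [norm_sub_rev ρ ε] at this
    linarith
  have hD2 : ‖D‖ ≤ 3 * ‖ε‖ := by
    have h3 := norm_sub_le (ρ - ε) (k * δ * ρ)
    have h4 := norm_sub_le ρ ε
    linarith
  have he0 : e ≠ 0 := norm_pos_iff.1 (by linarith)
  have hD0 : D ≠ 0 := norm_pos_iff.1 (by linarith)
  -- With β = tα, the conditions at α give w₂ = -v₂α and w₁ = ε/α - v₁α. Those at β become v₂t(t -
  -- 1)α² = δρ and kδρ + tε = ρ, which determine t and then α².
  obtain ⟨α, hα⟩ := IsAlgClosed.exists_pow_nat_eq (δ * ε ^ 2 / (v₂ * e * D)) (n := 2) two_pos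
  have hα0 : α ≠ 0 := by
    rintro rfl
    have : δ * ε ^ 2 / (v₂ * e * D) ≠ 0 := by positivity
    exact this (by rw [← hα]; simp)
  set t := ρ / ε * e with ht
  have ht1 : t - 1 = D / ε := by
    rw [ht, he, hD]; field_simp; ring
  have htn : ‖t‖ ≤ 2 := by
    rw [ht, norm_mul, norm_div]
    have h3 : ‖ρ‖ / ‖ε‖ ≤ 1 := (div_le_one hεn).2 h1
    calc ‖ρ‖ / ‖ε‖ * ‖e‖ ≤ 1 * (5 / 4) := by gcongr
      _ ≤ 2 := by norm_num
  have hαn : ‖α‖ ^ 2 = ‖δ‖ * ‖ε‖ ^ 2 / (‖v₂‖ * ‖e‖ * ‖D‖) := by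
    rw [← norm_pow, hα]; simp
  have hstep : v₂ * (t * α) * (t * α - α) = δ * ρ := by
    have : v₂ * (t * α) * (t * α - α) = v₂ * t * (t - 1) * α ^ 2 := by ring
    rw [this, hα, ht1, ht]
    field_simp
  refine ⟨α, t * α, ε / α - v₁ * α, -(v₂ * α), hα0, mul_ne_zero ?_ hα0, ?_, ?_, by ring, ?_, ?_,
    ?_, ?_, by simp, ε / α, ?_, ?_⟩
  · rw [ht]; positivity
  · intro h
    have h3 : (t - 1) * α = 0 := by rw [sub_mul, one_mul, ← h, sub_self]
    rw [ht1] at h3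
    exact (mul_ne_zero (div_ne_zero hD0 hε) hα0) h3
  · field_simp; ring
  · have h3 : t * α * (v₁ * (t * α) + (ε / α - v₁ * α))
        = k * (v₂ * (t * α) * (t * α - α)) + t * ε := by
      rw [hv₁]; field_simp; ring
    rw [h3, hstep, ht, he]
    field_simp
    ring
  · rw [← hstep]; ring
  · rw [hαn, div_le_div_iff₀ (by positivity) hvn]
    have h3 : 3 / 4 * (‖ε‖ / 4) ≤ ‖e‖ * ‖D‖ := by gcongr
    have h4 : 0 ≤ ‖δ‖ * ‖ε‖ * ‖v₂‖ := by positivity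
    nlinarith
  · rw [norm_mul]; gcongr
  · rw [norm_div, div_pow, hαn]
    have h3 : ‖e‖ * ‖D‖ ≤ 5 / 4 * (3 * ‖ε‖) := by gcongr
    have h4 : ‖ε‖ ^ 2 / (‖δ‖ * ‖ε‖ ^ 2 / (‖v₂‖ * ‖e‖ * ‖D‖)) = ‖v₂‖ * (‖e‖ * ‖D‖) / ‖δ‖ := by
      have : ‖e‖ ≠ 0 := norm_ne_zero_iff.2 he0
      have : ‖D‖ ≠ 0 := norm_ne_zero_iff.2 hD0
      field_simp
    rw [h4]
    gcongr ?_ / _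
    nlinarith
  · exact (norm_sub_le _ _).trans (by rw [norm_mul])

/-- The conics through the three poles degenerate to a double line through the origin. -/
theorem eventually_exists_conic {E : Set ℂ} (hE0 : (0 : ℂ) ∉ E) {ρ δ : ℂ → ℂ}
    (hρ0 : ∀ ε ∈ E, ρ ε ≠ 0) (hρ1 : ∀ ε ∈ E, ‖ρ ε‖ ≤ ‖ε‖) (hρ2 : ∀ ε ∈ E, ‖ρ ε‖ ≤ ‖ε - ρ ε‖)
    (hδ0 : ∀ ε ∈ E, δ ε ≠ 0) (hδ : Tendsto δ (𝓝[E] 0) (𝓝 0))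
    (hlog : Tendsto (fun ε => log ‖δ ε‖ / log ‖ε‖) (𝓝[E] 0) (𝓝 0))
    (v₁ : ℂ) {v₂ : ℂ} (hv₂ : v₂ ≠ 0) {τ : ℝ} (hτ : 0 < τ) :
    ∀ᶠ ε in 𝓝[E] 0, ∃ α β w₁ w₂ : ℂ, α ≠ 0 ∧ β ≠ 0 ∧ α ≠ β ∧
      α * (v₁ * α + w₁) = ε ∧ α * (v₂ * α + w₂) = 0 ∧
      β * (v₁ * β + w₁) = ρ ε ∧ β * (v₂ * β + w₂) = δ ε * ρ ε ∧
      ‖α‖ < τ ∧ ‖β‖ < τ ∧ ‖w₁‖ < τ ∧ ‖w₂‖ < τ := by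
  have hvn : 0 < ‖v₂‖ := norm_pos_iff.2 hv₂
  set σ := τ / (2 + ‖v₁‖ + ‖v₂‖) with hσdef
  have hσ : 0 < σ := by positivity
  have hστ : σ * (2 + ‖v₁‖ + ‖v₂‖) = τ := by rw [hσdef]; field_simp
  have hid : Tendsto (fun ε : ℂ => ε) (𝓝[E] 0) (𝓝 0) := tendsto_id.mono_left nhdsWithin_le_nhds
  have e1 : ∀ᶠ ε in 𝓝[E] 0, ‖v₁ / v₂ * δ ε‖ < 1 / 4 := by
    have := (hδ.const_mul (v₁ / v₂)).norm
    rw [mul_zero, norm_zero] at this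
    exact this.eventually (gt_mem_nhds (by norm_num))
  have e2 : ∀ᶠ ε in 𝓝[E] 0, 6 * ‖δ ε‖ * ‖ε‖ / ‖v₂‖ < σ ^ 2 := by
    have := ((hδ.norm.const_mul 6).mul hid.norm).div_const ‖v₂‖
    simp only [norm_zero, mul_zero, zero_div] at this
    exact this.eventually (gt_mem_nhds (by positivity))
  have e3 : ∀ᶠ ε in 𝓝[E] 0, 4 * ‖v₂‖ * ‖δ ε‖ < σ ^ 2 := by
    have := hδ.norm.const_mul (4 * ‖v₂‖)
    rw [norm_zero, mul_zero] at this
    exact this.eventually (gt_mem_nhds (by positivity))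
  have e4 : ∀ᶠ ε in 𝓝[E] 0, ‖ε‖ < 1 := by
    have := hid.norm
    rw [norm_zero] at this
    exact this.eventually (gt_mem_nhds one_pos)
  have e5 : ∀ᶠ ε in 𝓝[E] 0, log ‖δ ε‖ / log ‖ε‖ < 1 / 2 :=
    hlog.eventually (gt_mem_nhds (by norm_num))
  filter_upwards [e1, e2, e3, e4, e5, self_mem_nhdsWithin] with ε h1 h2 h3 h4 h5 hε
  have hε0 : ε ≠ 0 := fun h => hE0 (h ▸ hε)
  have hεn : 0 < ‖ε‖ := norm_pos_iff.2 hε0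
  have hδn : 0 < ‖δ ε‖ := norm_pos_iff.2 (hδ0 ε hε)
  -- A ratio of logarithms below 1/2 means |ε| ≤ |δ|², so |ε|/|δ| ≤ |δ| and q is small.
  have hεδ : ‖ε‖ ≤ ‖δ ε‖ ^ 2 := by
    have hl : log ‖ε‖ < 0 := log_neg hεn h4
    rw [div_lt_iff_of_neg hl] at h5
    rw [← log_le_log_iff hεn (by positivity), log_pow]
    push_cast
    linarith
  obtain ⟨α, β, w₁, w₂, hα, hβ, hαβ, g1, g2, g3, g4, b1, b2, b3, q, b4, b5⟩ :=
    exists_conic_through_threePoints (v₁ := v₁) hv₂ hε0 (hρ0 ε hε) (hδ0 ε hε) (hρ1 ε hε)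
      (hρ2 ε hε) h1.le
  have hασ : ‖α‖ < σ := lt_of_pow_lt_pow_left₀ 2 hσ.le (b1.trans_lt h2)
  have hqσ : ‖q‖ < σ := by
    refine lt_of_pow_lt_pow_left₀ 2 hσ.le (b4.trans_lt (lt_of_le_of_lt ?_ h3))
    rw [div_le_iff₀ hδn]
    have : 4 * ‖v₂‖ * ‖ε‖ ≤ 4 * ‖v₂‖ * ‖δ ε‖ ^ 2 := by gcongr
    linarith
  have m1 : ‖v₁‖ * ‖α‖ ≤ ‖v₁‖ * σ := by gcongr
  have m2 : ‖v₂‖ * ‖α‖ ≤ ‖v₂‖ * σ := by gcongr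
  have p1 : 0 ≤ ‖v₁‖ * σ := by positivity
  have p2 : 0 ≤ ‖v₂‖ * σ := by positivity
  refine ⟨α, β, w₁, w₂, hα, hβ, hαβ, g1, g2, g3, g4, ?_, ?_, ?_, ?_⟩ <;> nlinarith

/-! ### Cubic correction and choice of parameters -/

/-- The cubic in one variable through `0` and `ζ (v ζ + w)` at `α, β`, with value `x` at `s`. -/
noncomputable def cubic (v x s α β w ζ : ℂ) : ℂ :=
  ζ * (v * ζ + w) + (x - s * (v * s + w)) / (s * (s - α) * (s - β)) * (ζ * (ζ - α) * (ζ - β))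

theorem cubic_apply_self {v x s α β w : ℂ} (hs : s ≠ 0) (hα : s ≠ α) (hβ : s ≠ β) :
    cubic v x s α β w s = x := by
  have h1 := sub_ne_zero.2 hα
  have h2 := sub_ne_zero.2 hβ
  unfold cubic
  field_simp
  ring

theorem norm_cubic_le (v x s α β w : ℂ) {ζ : ℂ} (hζ : ‖ζ‖ ≤ 1) :
    ‖cubic v x s α β w ζ‖ ≤ ‖v‖ + ‖w‖
      + ‖(x - s * (v * s + w)) / (s * (s - α) * (s - β))‖ * ((1 + ‖α‖) * (1 + ‖β‖)) := by
  refine (norm_add_le _ _).trans (add_le_add ?_ ?_)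
  · rw [norm_mul]
    calc ‖ζ‖ * ‖v * ζ + w‖ ≤ 1 * (‖v‖ * 1 + ‖w‖) := by
          gcongr
          refine (norm_add_le _ _).trans ?_
          rw [norm_mul]
          gcongr
      _ = _ := by ring
  · rw [norm_mul]
    gcongr
    rw [norm_mul, norm_mul]
    have h1 : ‖ζ - α‖ ≤ 1 + ‖α‖ := (norm_sub_le _ _).trans (by gcongr)
    have h2 : ‖ζ - β‖ ≤ 1 + ‖β‖ := (norm_sub_le _ _).trans (by gcongr)
    calc ‖ζ‖ * ‖ζ - α‖ * ‖ζ - β‖ ≤ 1 * (1 + ‖α‖) * (1 + ‖β‖) := by gcongr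
      _ = _ := by ring

/-- As α, β, w → 0 the bound of `norm_cubic_le` tends to the left side of `h`. -/
theorem eventually_norm_cubic_lt {v x s : ℂ} (hs : s ≠ 0)
    (h : ‖v‖ + ‖x - s * (v * s)‖ / ‖s‖ ^ 3 < 1) :
    ∀ᶠ a : ℂ × ℂ × ℂ in 𝓝 0, ∀ ζ, ‖ζ‖ ≤ 1 → ‖cubic v x s a.1 a.2.1 a.2.2 ζ‖ < 1 := by
  have hc : ContinuousAt (fun a : ℂ × ℂ × ℂ => ‖v‖ + ‖a.2.2‖
      + ‖(x - s * (v * s + a.2.2)) / (s * (s - a.1) * (s - a.2.1))‖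
        * ((1 + ‖a.1‖) * (1 + ‖a.2.1‖))) 0 := by
    have : ContinuousAt (fun a : ℂ × ℂ × ℂ =>
        (x - s * (v * s + a.2.2)) / (s * (s - a.1) * (s - a.2.1))) 0 :=
      ContinuousAt.div (by fun_prop) (by fun_prop) (by simpa using hs)
    fun_prop
  have hv : ‖v‖ + ‖x - s * (v * s)‖ / (‖s‖ * ‖s‖ * ‖s‖) < 1 := by
    rwa [show ‖s‖ * ‖s‖ * ‖s‖ = ‖s‖ ^ 3 by ring]
  filter_upwards [hc.tendsto.eventually_lt_const (u := 1) (by simpa using hv)] with a ha ζ hζ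
  exact (norm_cubic_le _ _ _ _ _ _ hζ).trans_lt ha

/-- Any s slightly above √M works: M < s² leaves room for the leading coefficient, and 3 log √M =
(3/2) log M. -/
theorem exists_radius {M y : ℝ} (hM0 : 0 < M) (hM1 : M < 1) (hy : 3 / 2 * log M < y) :
    ∃ s : ℝ, 0 < s ∧ s < 1 ∧ M < s ^ 2 ∧ 3 * log s < y := by
  have hs0 : 0 < √M := sqrt_pos.2 hM0
  have hs1 : √M < 1 := by rw [sqrt_lt' one_pos]; simpa using hM1
  have hc : ContinuousAt (fun s => 3 * log s) √M := (continuousAt_log hs0.ne').const_mul 3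
  have hl : 3 * log √M < y := by rw [log_sqrt hM0.le]; linarith
  obtain ⟨s, h1, h2⟩ := (((hc.tendsto.mono_left nhdsWithin_le_nhds).eventually_lt_const
    hl).and (Ioo_mem_nhdsGT hs1)).exists
  exact ⟨s, hs0.trans h2.1, h2.2, (sqrt_lt' (hs0.trans h2.1)).1 h2.1, h1⟩

/-- The choice v = x/s² removes the limiting cubic term. If x = 0 this would vanish, whereas the
conic needs v₂ ≠ 0; then v = s/4 gives s/4 + 1/4 < 1. -/
theorem exists_leading_coeff {x : ℂ} {s : ℝ} (hs0 : 0 < s) (hs1 : s < 1) (hx : ‖x‖ < s ^ 2) :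
    ∃ v : ℂ, v ≠ 0 ∧ ‖v‖ + ‖x - s * (v * s)‖ / ‖(s : ℂ)‖ ^ 3 < 1 := by
  have hsn : ‖(s : ℂ)‖ = s := by simp [abs_of_pos hs0]
  have hsc : (s : ℂ) ≠ 0 := by exact_mod_cast hs0.ne'
  by_cases h : x = 0
  · refine ⟨((s / 4 : ℝ) : ℂ), by simpa using hs0.ne', ?_⟩
    have h1 : ‖((s / 4 : ℝ) : ℂ)‖ = s / 4 := by
      rw [Complex.norm_real, norm_of_nonneg (by positivity)]
    rw [h, zero_sub, norm_neg, norm_mul, norm_mul, h1, hsn]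
    have : s * (s / 4 * s) / s ^ 3 = 1 / 4 := by field_simp
    linarith
  · refine ⟨x / s ^ 2, div_ne_zero h (pow_ne_zero _ hsc), ?_⟩
    have h1 : x - s * (x / s ^ 2 * s) = 0 := by field_simp; ring
    rw [h1, norm_zero, zero_div, add_zero, norm_div, norm_pow, hsn, div_lt_one (by positivity)]
    exact hx

/-- Each of the three terms tends to log s. Distinctness is needed for the finite set to contribute
three terms. -/
theorem eventually_logPoles_lt {s : ℝ} (hs : 0 < s) {y : ℝ} (hy : 3 * log s < y) :
    ∀ᶠ a : ℂ × ℂ in 𝓝 0, a.1 ≠ 0 → a.2 ≠ 0 → a.1 ≠ a.2 → logPoles {0, a.1, a.2} s < y := by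
  have hsc : (s : ℂ) ≠ 0 := by exact_mod_cast hs.ne'
  have hterm : ∀ f : ℂ × ℂ → ℂ, ContinuousAt f 0 → f 0 = 0 →
      Tendsto (fun a => log ‖(s : ℂ) - f a‖ - log (1 - ‖f a‖)) (𝓝 0) (𝓝 (log s)) := by
    intro f hf h0
    have h1 : ContinuousAt (fun a => ‖(s : ℂ) - f a‖) 0 := by fun_prop
    have h2 : ContinuousAt (fun a => 1 - ‖f a‖) 0 := by fun_prop
    have h3 := ((h1.log (by simpa [h0] using hs.ne')).sub (h2.log (by simp [h0]))).tendsto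
    simpa [h0, abs_of_pos hs, Pi.sub_def] using h3
  have hsum := (hterm (fun _ => 0) (by fun_prop) rfl).add
    ((hterm Prod.fst (by fun_prop) rfl).add (hterm Prod.snd (by fun_prop) rfl))
  filter_upwards [hsum.eventually_lt_const (u := y) (by linarith)] with a ha h1 h2 h12
  unfold logPoles
  rw [Finset.sum_insert (by simp [h1.symm, h2.symm]), Finset.sum_insert (by simpa using h12),
    Finset.sum_singleton]
  exact ha

end GreenLimit

/-! ### Conclusion -/

open GreenLimit in
theorem proposition4
    (E : Set ℂ) (hE0 : (0 : ℂ) ∉ E) (hE : (0 : ℂ) ∈ closure E)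
    (ρ δ : ℂ → ℂ)
    (hρ0 : ∀ ε ∈ E, ρ ε ≠ 0)
    (hρ1 : ∀ ε ∈ E, ‖ρ ε‖ ≤ ‖ε‖)
    (hρ2 : ∀ ε ∈ E, ‖ρ ε‖ ≤ ‖ε - ρ ε‖)
    (hδ0 : ∀ ε ∈ E, δ ε ≠ 0)
    (hδ : Tendsto δ (𝓝[E] 0) (𝓝 0))
    (hlog : Tendsto (fun ε => Real.log ‖δ ε‖ / Real.log ‖ε‖) (𝓝[E] 0) (𝓝 0))
    (z : ℂ × ℂ) (hz : z ∈ GreenLimit.bidisk) (hz0 : z ≠ 0) :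
    limsup (fun ε => GreenLimit.greenSet GreenLimit.bidisk
        (GreenLimit.threePoints ε (ρ ε) (δ ε)) z) (𝓝[E] 0)
      ≤ ((3 / 2 * Real.log (max ‖z.1‖ ‖z.2‖) : ℝ) : EReal) := by
  have hM0 : 0 < max ‖z.1‖ ‖z.2‖ := norm_pos_iff.2 hz0
  have hM1 : max ‖z.1‖ ‖z.2‖ < 1 :=
    max_lt (mem_ball_zero_iff.1 hz.1) (mem_ball_zero_iff.1 hz.2)
  refine EReal.le_of_forall_lt_iff_le.1 fun y hy => ?_
  rw [EReal.coe_lt_coe_iff] at hy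
  obtain ⟨s, hs0, hs1, hMs, hsy⟩ := exists_radius hM0 hM1 hy
  have hsc : (s : ℂ) ≠ 0 := by exact_mod_cast hs0.ne'
  obtain ⟨v₁, -, hv₁⟩ := exists_leading_coeff hs0 hs1 ((le_max_left _ _).trans_lt hMs)
  obtain ⟨v₂, hv₂0, hv₂⟩ := exists_leading_coeff hs0 hs1 ((le_max_right _ _).trans_lt hMs)
  obtain ⟨τ₁, hτ₁, hb₁⟩ := Metric.eventually_nhds_iff_ball.1 (eventually_norm_cubic_lt hsc hv₁)
  obtain ⟨τ₂, hτ₂, hb₂⟩ := Metric.eventually_nhds_iff_ball.1 (eventually_norm_cubic_lt hsc hv₂)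
  obtain ⟨τ₃, hτ₃, hb₃⟩ := Metric.eventually_nhds_iff_ball.1 (eventually_logPoles_lt hs0 hsy)
  -- Here τ₁, τ₂ keep the two coordinates in the unit disk, τ₃ controls the bound at s, and s keeps
  -- α, β away from s.
  have hτ : 0 < min (min τ₁ τ₂) (min τ₃ s) := by positivity
  refine limsup_le_of_le (by isBoundedDefault) ?_
  filter_upwards [eventually_exists_conic hE0 hρ0 hρ1 hρ2 hδ0 hδ hlog v₁ hv₂0 hτ] with ε h
  obtain ⟨α, β, w₁, w₂, hα, hβ, hαβ, g1, g2, g3, g4, b1, b2, b3, b4⟩ := h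
  simp only [lt_min_iff] at b1 b2 b3 b4
  have hsα : ‖α‖ < ‖(s : ℂ)‖ := by simpa [abs_of_pos hs0] using b1.2.2
  have hsβ : ‖β‖ < ‖(s : ℂ)‖ := by simpa [abs_of_pos hs0] using b2.2.2
  have hsα' : (s : ℂ) ≠ α := fun h => by rw [h] at hsα; exact lt_irrefl _ hsα
  have hsβ' : (s : ℂ) ≠ β := fun h => by rw [h] at hsβ; exact lt_irrefl _ hsβ
  have hφz : (cubic v₁ z.1 s α β w₁ s, cubic v₂ z.2 s α β w₂ s) = z := by
    rw [cubic_apply_self hsc hsα' hsβ', cubic_apply_self hsc hsα' hsβ']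
  have hle := greenSet_le_logPoles isOpen_bidisk (S := threePoints ε (ρ ε) (δ ε))
    (φ := fun ζ => (cubic v₁ z.1 s α β w₁ ζ, cubic v₂ z.2 s α β w₂ ζ))
    (by unfold cubic; fun_prop)
    (fun ζ hζ => ⟨mem_ball_zero_iff.2 (hb₁ (α, β, w₁)
        (by simp [Prod.norm_def, b1.1.1, b2.1.1, b3.1.1]) ζ hζ),
      mem_ball_zero_iff.2 (hb₂ (α, β, w₂)
        (by simp [Prod.norm_def, b1.1.2, b2.1.2, b4.1.2]) ζ hζ)⟩)
    (A := {0, α, β})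
    (by
      have h1 : ‖(s : ℂ)‖ < 1 := by simpa [abs_of_pos hs0] using hs1
      simp only [Finset.mem_insert, Finset.mem_singleton]
      rintro a (rfl | rfl | rfl)
      · simp
      · exact hsα.trans h1
      · exact hsβ.trans h1)
    (by
      simp only [Finset.mem_insert, Finset.mem_singleton]
      rintro a (rfl | rfl | rfl)
      · left; simp [cubic]
      · right; left; simp [cubic, g1, g2]
      · right; right; simp [cubic, g3, g4])
    (s := s) (by simpa [abs_of_pos hs0] using hs1.le) (by simp [hsc, hsα', hsβ'])
  rw [hφz] at hle
  exact hle.trans (EReal.coe_le_coe_iff.2 (hb₃ (α, β)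
    (by simp [Prod.norm_def, b1.2.1, b2.2.1]) hα hβ hαβ).le)
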